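/- Let $\mathscr A$ be a (not necessarily unital) $C^*$-algebra and let $\mathscr E$ be a Hilbert $C^*$-module over $\mathscr A$, that is, an $\mathscr A$-module with an $\mathscr A$-valued inner product $\langle\cdot,\cdot\rangle$ that is complete for the norm $\|x\|=\|\langle x,x\rangle\|^{1/2}$. Let $\mathcal L(\mathscr E)$ be the $C^*$-algebra of adjointable operators on $\mathscr E$, i.e. of the operators $T:\mathscr E\to\mathscr E$ for which there is an operator $T^*:\mathscr E\to\mathscr E$ with $\langle Tx,y\rangle=\langle x,T^*y\rangle$ for all $x,y\in\mathscr E$, and write $T\le S$ if $\langle x,Tx\rangle\le\langle x,Sx\rangle$ in $\mathscr A$ for all $x\in\mathscr E$. Let $\mathscr R(T)$ denote the range of $T$. Suppose that $\mathcal L(\mathscr E)$ is a $W^*$-algebra (a $C^*$-algebra that is isometrically isomorphic to the dual of a Banach space). Let $A,B\in\mathcal L(\mathscr E)$ and suppose that $\overline{\mathscr R(A^*)}=\mathscr E$. Then $BB^*\le\lambda AA^*$ for some real $\lambda>0$ if and only if $\mathscr R(B)\subseteq\mathscr R(A)$. -/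

import Mathlib

open scoped InnerProductSpace

/-! Adjointable operators on a Hilbert C⋆-module. The module is Mathlib's `CStarModule 𝒜 E` on a
complete space `E`; the coefficient algebra `𝒜` is an arbitrary, possibly non-unital, C⋆-algebra.
The compatibility of the action of `𝒜` with sums and products follows from the axioms of the
inner product. -/

set_option linter.unusedSectionVars false

namespace HilbertModule

noncomputable section

section Adjointable

variable (𝒜 E : Type*) [NonUnitalCStarAlgebra 𝒜] [PartialOrder 𝒜] [StarOrderedRing 𝒜]
  [SMul 𝒜 E] [NormedAddCommGroup E] [NormedSpace ℂ E] [CStarModule 𝒜 E]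

variable {E} in
theorem ext_inner {u v : E} (h : ∀ x : E, ⟪x, u⟫_𝒜 = ⟪x, v⟫_𝒜) : u = v := by
  have h1 : ⟪u - v, u - v⟫_𝒜 = 0 := by
    rw [CStarModule.inner_sub_right, h (u - v), sub_self]
  exact sub_eq_zero.mp (CStarModule.inner_self.mp h1)

/-- `𝓛(E)`: the operators `T` on `E` that have an adjoint `S`, that is,
`⟪T x, y⟫ = ⟪x, S y⟫` for all `x` and `y`. -/
def adjointable : Subalgebra ℂ (E →L[ℂ] E) where
  carrier := {T | ∃ S : E →L[ℂ] E, ∀ x y : E, ⟪T x, y⟫_𝒜 = ⟪x, S y⟫_𝒜}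
  mul_mem' := by
    rintro T T' ⟨S, hS⟩ ⟨S', hS'⟩
    exact ⟨S' * S, fun x y => by simp [hS, hS']⟩
  add_mem' := by
    rintro T T' ⟨S, hS⟩ ⟨S', hS'⟩
    exact ⟨S + S', fun x y => by simp [hS, hS']⟩
  algebraMap_mem' c := ⟨algebraMap ℂ (E →L[ℂ] E) (star c), fun x y => by
    simp [Algebra.algebraMap_eq_smul_one]⟩

variable {𝒜 E}

/-- On a complete module, every map that has an adjoint (no linearity or boundedness being
assumed) is a bounded linear operator that belongs to `𝓛(E)`. -/
theorem exists_mem_adjointable_of_adjoint [CompleteSpace E] (T S : E → E)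
    (h : ∀ x y : E, ⟪T x, y⟫_𝒜 = ⟪x, S y⟫_𝒜) :
    ∃ T' ∈ adjointable 𝒜 E, ∀ x, T' x = T x := by
  have key : ∀ T S : E → E, (∀ x y : E, ⟪T x, y⟫_𝒜 = ⟪x, S y⟫_𝒜) →
      ∃ T' : E →L[ℂ] E, ∀ x, T' x = T x := by
    intro T S h
    have h' : ∀ x y : E, ⟪y, T x⟫_𝒜 = ⟪S y, x⟫_𝒜 := fun x y => by
      rw [← CStarModule.star_inner, h, CStarModule.star_inner]
    let L : E →ₗ[ℂ] E :=
      { toFun := T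
        map_add' := fun a b => ext_inner 𝒜 fun y => by simp [h']
        map_smul' := fun c a => ext_inner 𝒜 fun y => by simp [h'] }
    have hL : Continuous L := by
      refine L.continuous_of_seq_closed_graph fun u x y hu hy => ext_inner 𝒜 fun z => ?_
      have h1 : Filter.Tendsto (fun n => ⟪z, L (u n)⟫_𝒜) Filter.atTop (nhds ⟪z, y⟫_𝒜) :=
        ((CStarModule.innerSL (A := 𝒜) z).continuous.tendsto y).comp hy
      have h2 : Filter.Tendsto (fun n => ⟪S z, u n⟫_𝒜) Filter.atTop (nhds ⟪S z, x⟫_𝒜) :=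
        ((CStarModule.innerSL (A := 𝒜) (S z)).continuous.tendsto x).comp hu
      have h3 : (fun n => ⟪z, L (u n)⟫_𝒜) = fun n => ⟪S z, u n⟫_𝒜 := funext fun n => h' _ _
      rw [h3] at h1
      exact (tendsto_nhds_unique h1 h2).trans (h' x z).symm
    exact ⟨⟨L, hL⟩, fun _ => rfl⟩
  obtain ⟨T', hT'⟩ := key T S h
  obtain ⟨S', hS'⟩ := key S T fun x y => by
    rw [← CStarModule.star_inner, ← h, CStarModule.star_inner]
  exact ⟨T', ⟨S', fun x y => by rw [hT', hS', h]⟩, hT'⟩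

variable (𝒜 E) in
/-- `𝓛(E)` as a type, with the algebra structure and the operator norm of `E →L[ℂ] E`. -/
def Adjointable : Type _ := adjointable 𝒜 E

instance : NormedRing (Adjointable 𝒜 E) := inferInstanceAs (NormedRing (adjointable 𝒜 E))

instance : NormedAlgebra ℂ (Adjointable 𝒜 E) :=
  inferInstanceAs (NormedAlgebra ℂ (adjointable 𝒜 E))

/-- The underlying bounded operator. -/
def Adjointable.toCLM (T : Adjointable 𝒜 E) : E →L[ℂ] E := Subtype.val T

instance : CoeFun (Adjointable 𝒜 E) fun _ => E → E := ⟨fun T => T.toCLM⟩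

namespace Adjointable

theorem ext {T S : Adjointable 𝒜 E} (h : ∀ x, T x = S x) : T = S :=
  Subtype.ext (ContinuousLinearMap.ext h)

@[simp] theorem add_apply (T S : Adjointable 𝒜 E) (x : E) : (T + S) x = T x + S x := rfl

@[simp] theorem sub_apply (T S : Adjointable 𝒜 E) (x : E) : (T - S) x = T x - S x := rfl

@[simp] theorem mul_apply (T S : Adjointable 𝒜 E) (x : E) : (T * S) x = T (S x) := rfl

@[simp] theorem smul_apply (c : ℂ) (T : Adjointable 𝒜 E) (x : E) : (c • T) x = c • T x := rfl

theorem norm_def (T : Adjointable 𝒜 E) : ‖T‖ = ‖T.toCLM‖ := rfl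

/-- The involution of `𝓛(E)` is the passage to the (unique) adjoint. -/
instance : Star (Adjointable 𝒜 E) where
  star T := ⟨T.2.choose, T.toCLM, fun x y => by
    rw [← CStarModule.star_inner, ← T.2.choose_spec, CStarModule.star_inner]; rfl⟩

theorem inner_left (T : Adjointable 𝒜 E) (x y : E) : ⟪T x, y⟫_𝒜 = ⟪x, (star T) y⟫_𝒜 :=
  T.2.choose_spec x y

theorem star_eq_of_inner {T S : Adjointable 𝒜 E}
    (h : ∀ x y : E, ⟪T x, y⟫_𝒜 = ⟪x, S y⟫_𝒜) : star T = S :=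
  ext fun y => ext_inner 𝒜 fun x => by rw [← inner_left, h]

theorem inner_right (T : Adjointable 𝒜 E) (x y : E) : ⟪x, T y⟫_𝒜 = ⟪(star T) x, y⟫_𝒜 := by
  rw [← CStarModule.star_inner, inner_left, CStarModule.star_inner]

instance : StarRing (Adjointable 𝒜 E) where
  star_involutive T := star_eq_of_inner fun x y => (inner_right T x y).symm
  star_mul T S := star_eq_of_inner fun x y => by simp [inner_left]
  star_add T S := star_eq_of_inner fun x y => by simp [inner_left]

instance : StarModule ℂ (Adjointable 𝒜 E) where
  star_smul c T := star_eq_of_inner fun x y => by simp [inner_left]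

instance : CStarRing (Adjointable 𝒜 E) where
  norm_mul_self_le T := by
    have hsq : ∀ x : E, ‖T x‖ ^ 2 ≤ ‖star T * T‖ * ‖x‖ ^ 2 := fun x => by
      rw [CStarModule.norm_sq_eq 𝒜, inner_left]
      calc ‖⟪x, (star T * T) x⟫_𝒜‖
          ≤ ‖x‖ * ‖(star T * T) x‖ := CStarModule.norm_inner_le E
        _ ≤ ‖x‖ * (‖star T * T‖ * ‖x‖) := by
            gcongr
            exact (star T * T).toCLM.le_opNorm x
        _ = ‖star T * T‖ * ‖x‖ ^ 2 := by ring
    have h1 : ‖T‖ ≤ √‖star T * T‖ := by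
      refine T.toCLM.opNorm_le_bound (Real.sqrt_nonneg _) fun x => ?_
      rw [← Real.sqrt_sq (norm_nonneg x), ← Real.sqrt_mul (norm_nonneg _)]
      exact Real.le_sqrt_of_sq_le (hsq x)
    calc ‖T‖ * ‖T‖ ≤ √‖star T * T‖ * √‖star T * T‖ := by gcongr
      _ = ‖star T * T‖ := Real.mul_self_sqrt (norm_nonneg _)

end Adjointable

theorem isClosed_adjointable [CompleteSpace E] :
    IsClosed (adjointable 𝒜 E : Set (E →L[ℂ] E)) := by
  refine isClosed_of_closure_subset fun T hT => ?_
  obtain ⟨u, hu, hlim⟩ := mem_closure_iff_seq_limit.mp hT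
  let t : ℕ → Adjointable 𝒜 E := fun n => ⟨u n, hu n⟩
  have hc : CauchySeq fun n => (star (t n)).toCLM := by
    have h0 : CauchySeq u := hlim.cauchySeq
    rw [Metric.cauchySeq_iff] at h0 ⊢
    intro ε hε
    obtain ⟨N, hN⟩ := h0 ε hε
    refine ⟨N, fun m hm n hn => ?_⟩
    have h2 : ‖star (t m) - star (t n)‖ = ‖t m - t n‖ := by rw [← star_sub, norm_star]
    have h3 := hN m hm n hn
    rw [dist_eq_norm] at h3 ⊢
    exact lt_of_eq_of_lt h2 h3
  obtain ⟨S, hS⟩ := cauchySeq_tendsto_of_complete hc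
  refine ⟨S, fun x y => ?_⟩
  have h1 : Filter.Tendsto (fun n => ⟪u n x, y⟫_𝒜) Filter.atTop (nhds ⟪T x, y⟫_𝒜) :=
    ((CStarModule.continuous_inner (A := 𝒜)).tendsto (T x, y)).comp
      ((((ContinuousLinearMap.apply ℂ E x).continuous.tendsto T).comp hlim).prodMk_nhds
        tendsto_const_nhds)
  have h2 : Filter.Tendsto (fun n => ⟪x, (star (t n)) y⟫_𝒜) Filter.atTop
      (nhds ⟪x, S y⟫_𝒜) :=
    ((CStarModule.continuous_inner (A := 𝒜)).tendsto (x, S y)).comp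
      (tendsto_const_nhds.prodMk_nhds
        (((ContinuousLinearMap.apply ℂ E y).continuous.tendsto S).comp hS))
  have h3 : (fun n => ⟪u n x, y⟫_𝒜) = fun n => ⟪x, (star (t n)) y⟫_𝒜 :=
    funext fun n => (t n).inner_left x y
  rw [h3] at h1
  exact tendsto_nhds_unique h1 h2

instance [CompleteSpace E] : CompleteSpace (Adjointable 𝒜 E) :=
  (isClosed_adjointable (𝒜 := 𝒜) (E := E)).completeSpace_coe

/-- `𝓛(E)` with the operator norm is a unital C⋆-algebra. -/
instance [CompleteSpace E] : CStarAlgebra (Adjointable 𝒜 E) where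

/-- The order of `𝓛(E)`: `T ≤ S` if `⟪x, T x⟫ ≤ ⟪x, S x⟫` in `𝒜` for every `x`, that is, if
`S - T` is a positive operator. -/
instance : PartialOrder (Adjointable 𝒜 E) where
  le T S := ∀ x : E, ⟪x, T x⟫_𝒜 ≤ ⟪x, S x⟫_𝒜
  le_refl T x := le_rfl
  le_trans T S R h h' x := (h x).trans (h' x)
  le_antisymm T S h h' := by
    have h0 : ∀ x : E, ⟪x, (T.toCLM - S.toCLM) x⟫_𝒜 = 0 := fun x => by
      simp [le_antisymm (h x) (h' x)]
    refine Subtype.ext (sub_eq_zero.mp (ContinuousLinearMap.ext fun y => ext_inner 𝒜 fun x => ?_))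
    set D := T.toCLM - S.toCLM
    have h1 := h0 (x + y)
    have h2 := h0 (x + Complex.I • y)
    simp only [map_add, map_smul, CStarModule.inner_add_left, CStarModule.inner_add_right, h0,
      CStarModule.inner_smul_left_complex, CStarModule.inner_smul_right_complex, smul_zero,
      zero_add, add_zero] at h1 h2
    have h3 : ⟪y, D x⟫_𝒜 = -⟪x, D y⟫_𝒜 := eq_neg_of_add_eq_zero_left h1
    rw [h3, smul_neg, ← neg_smul, ← add_smul] at h2
    have h4 : -(star Complex.I) + Complex.I ≠ 0 := by
      simp [Complex.ext_iff]
    exact ((smul_eq_zero.mp h2).resolve_left h4).trans CStarModule.inner_zero_right.symm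

end Adjointable

end

end HilbertModule

/-! If `B = A C` with `C` adjointable, then `B B⋆ = A C C⋆ A⋆ ≤ ‖C C⋆‖ A A⋆`, and the range of `B`
lies in that of `A`. So both implications reduce to producing an adjointable factor `C`.

From the range inclusion: density of the range of `A⋆` makes `A` injective, so `C` exists pointwise
and is bounded by the closed graph theorem. Its adjoint is forced to send `A⋆ y` to `B⋆ y`, and
density extends this to all of `E`.

From `b b⋆ ≤ k a a⋆`: put `pₙ = a a⋆ + εₙ` with `εₙ ↓ 0`. The elements `a⋆ pₙ⁻¹ b` are approximate
solutions, since `a a⋆ pₙ⁻¹ b → b` in norm; a weak-⋆ limit of them should be the factor. What is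
needed is that left multiplication by `a` passes to that limit. By polarization `a⋆ pₙ⁻¹ b` is a
combination of four bounded increasing sequences `v⋆ pₙ⁻¹ v`, and for such sequences weak-⋆ limits
are suprema, a purely order-theoretic notion that conjugation by units preserves; a second
polarization turns conjugation into left multiplication. -/

namespace HilbertModule

open Filter Topology

/-! ### Weak-⋆ limits along an ultrafilter -/

section PredualLimit

variable {M X : Type*} [CStarAlgebra M] [NormedAddCommGroup X] [NormedSpace ℂ X]

/-- Convergence of a sequence, along a fixed free ultrafilter on `ℕ`, in the weak-⋆ topology that
a predual `X` induces on `M`. -/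
def PredualLimit (e : StrongDual ℂ X ≃ₗᵢ⋆[ℂ] M) (x : ℕ → M) (a : M) : Prop :=
  Tendsto (fun n => StrongDual.toWeakDual (e.symm (x n))) (hyperfilter ℕ : Filter ℕ)
    (𝓝 (StrongDual.toWeakDual (e.symm a)))

namespace PredualLimit

variable {e : StrongDual ℂ X ≃ₗᵢ⋆[ℂ] M} {x y : ℕ → M} {a b : M}

theorem unique (h : PredualLimit e x a) (h' : PredualLimit e x b) : a = b := by
  have := tendsto_nhds_unique h h'
  simpa using this

theorem add (h : PredualLimit e x a) (h' : PredualLimit e y b) :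
    PredualLimit e (fun n => x n + y n) (a + b) := by
  have := Tendsto.add h h'
  simpa [PredualLimit] using this

theorem smul (c : ℂ) (h : PredualLimit e x a) : PredualLimit e (fun n => c • x n) (c • a) := by
  have := Tendsto.const_smul h (star c)
  simpa [PredualLimit, map_smulₛₗ] using this

theorem const (e : StrongDual ℂ X ≃ₗᵢ⋆[ℂ] M) (a : M) : PredualLimit e (fun _ => a) a :=
  tendsto_const_nhds

theorem sub (h : PredualLimit e x a) (h' : PredualLimit e y b) :
    PredualLimit e (fun n => x n - y n) (a - b) := by
  have := Tendsto.sub h h'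
  simpa [PredualLimit] using this

theorem of_tendsto (h : Tendsto x atTop (𝓝 a)) : PredualLimit e x a := by
  have h1 : Tendsto x (hyperfilter ℕ : Filter ℕ) (𝓝 a) :=
    h.mono_left (Nat.cofinite_eq_atTop ▸ hyperfilter_le_cofinite)
  exact ((NormedSpace.Dual.toWeakDual_continuous.comp e.symm.continuous).tendsto a).comp h1

theorem exists_of_norm_le (e : StrongDual ℂ X ≃ₗᵢ⋆[ℂ] M) {r : ℝ} (hx : ∀ n, ‖x n‖ ≤ r) :
    ∃ a, PredualLimit e x a := by
  have hc := WeakDual.isCompact_closedBall (𝕜 := ℂ) (E := X) 0 r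
  have hmem : WeakDual.toStrongDual ⁻¹' Metric.closedBall 0 r ∈
      (hyperfilter ℕ).map fun n => StrongDual.toWeakDual (e.symm (x n)) := by
    refine Filter.Eventually.of_forall (f := (hyperfilter ℕ : Filter ℕ)) fun n => ?_
    simpa using hx n
  obtain ⟨f, -, hf⟩ := hc.ultrafilter_le_nhds' _ hmem
  refine ⟨e (WeakDual.toStrongDual f), ?_⟩
  simpa [PredualLimit, Tendsto] using hf

theorem norm_le (h : PredualLimit e x a) {r : ℝ} (hx : ∀ᶠ n in atTop, ‖x n‖ ≤ r) : ‖a‖ ≤ r := by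
  have hx' : ∀ᶠ n in (hyperfilter ℕ : Filter ℕ), ‖x n‖ ≤ r :=
    hx.filter_mono (Nat.cofinite_eq_atTop ▸ hyperfilter_le_cofinite)
  have := (WeakDual.isClosed_closedBall (𝕜 := ℂ) (E := X) 0 r).mem_of_tendsto h
    (hx'.mono fun n hn => by simpa using hn)
  simpa using this

end PredualLimit

end PredualLimit

/-! ### Norm criteria and polarization in a C⋆-algebra -/

section CStar

variable {M : Type*} [CStarAlgebra M]

theorem norm_sq_add_I_smul_le {x : M} (hx : IsSelfAdjoint x) {r : ℝ} (hr : ‖x‖ ≤ r) (t : ℝ) :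
    ‖x + (t * Complex.I) • (1 : M)‖ ^ 2 ≤ r ^ 2 + t ^ 2 := by
  rw [sq, ← CStarRing.norm_star_mul_self]
  have : star (x + (t * Complex.I) • (1 : M)) * (x + (t * Complex.I) • (1 : M))
      = x * x + ((t : ℂ) ^ 2) • (1 : M) := by
    simp only [star_add, hx.star_eq, star_smul, star_one, add_mul, mul_add, smul_mul_assoc,
      mul_smul_comm, one_mul, mul_one, RCLike.star_def, map_mul, Complex.conj_ofReal,
      Complex.conj_I]
    have hI : (t * Complex.I) * (t * -Complex.I) = (t : ℂ) ^ 2 := by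
      linear_combination (-(t : ℂ) ^ 2) * Complex.I_sq
    rw [smul_add, smul_smul, hI]
    module
  rw [this]
  calc _ ≤ ‖x * x‖ + ‖((t : ℂ) ^ 2) • (1 : M)‖ := norm_add_le _ _
    _ ≤ r ^ 2 + t ^ 2 := by
      gcongr
      · calc ‖x * x‖ ≤ ‖x‖ * ‖x‖ := norm_mul_le _ _
          _ ≤ r ^ 2 := by
            rw [sq]
            exact mul_self_le_mul_self (norm_nonneg x) hr
      · have h1 : ‖(1 : M)‖ ≤ 1 := by
          rcases subsingleton_or_nontrivial M with _ | _
          · simp [Subsingleton.elim (1 : M) 0]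
          · simp
        calc ‖((t : ℂ) ^ 2) • (1 : M)‖ = t ^ 2 * ‖(1 : M)‖ := by simp [norm_smul]
          _ ≤ t ^ 2 := mul_le_of_le_one_right (sq_nonneg t) h1

theorem polarization (p q y : M) :
    (4 : ℂ) • (star q * y * p) =
      star (p + (1 : ℂ) • q) * y * (p + (1 : ℂ) • q)
        + (-1 : ℂ) • (star (p + (-1 : ℂ) • q) * y * (p + (-1 : ℂ) • q))
        + Complex.I • (star (p + Complex.I • q) * y * (p + Complex.I • q))
        + (-Complex.I) • (star (p + (-Complex.I) • q) * y * (p + (-Complex.I) • q)) := by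
  simp only [star_add, star_smul, add_mul, mul_add, smul_mul_assoc, mul_smul_comm, smul_add,
    smul_smul, star_neg, star_one, RCLike.star_def, Complex.conj_I, neg_neg, mul_neg, neg_mul,
    Complex.I_mul_I, mul_one]
  module

variable [PartialOrder M] [StarOrderedRing M]

theorem nonpos_of_forall_smul_le {b : M} {r : ℝ} (h : ∀ t : ℝ, 0 < t → t • b ≤ algebraMap ℝ M r) :
    b ≤ 0 := by
  have h1 : Tendsto (fun t : ℝ => t⁻¹ • algebraMap ℝ M r) atTop (𝓝 ((0 : ℝ) • algebraMap ℝ M r)) :=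
    tendsto_inv_atTop_zero.smul_const _
  rw [zero_smul] at h1
  refine ge_of_tendsto h1 ((eventually_gt_atTop 0).mono fun t ht => ?_)
  have := smul_le_smul_of_nonneg_left (h t ht) (inv_nonneg.mpr ht.le)
  rwa [smul_smul, inv_mul_cancel₀ ht.ne', one_smul] at this

/-- Expanding the square cancels `t ^ 2`; dropping `b * b ≥ 0` leaves `2 t b ≤ r ^ 2` for all real
`t`, and `t → ±∞` forces `b = 0`. -/
theorem eq_zero_of_forall_norm_sq_add_le {b : M} (hb : IsSelfAdjoint b) {r : ℝ}
    (h : ∀ t : ℝ, ‖b + algebraMap ℝ M t‖ ^ 2 ≤ r ^ 2 + t ^ 2) : b = 0 := by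
  have key : ∀ t : ℝ, t • b ≤ algebraMap ℝ M (r ^ 2 / 2) := fun t => by
    have hsa : IsSelfAdjoint (b + algebraMap ℝ M t) := hb.add (IsSelfAdjoint.algebraMap M (.all t))
    have h1 : star (b + algebraMap ℝ M t) * (b + algebraMap ℝ M t) ≤
        algebraMap ℝ M (r ^ 2 + t ^ 2) :=
      CStarAlgebra.star_mul_le_algebraMap_norm_sq.trans (algebraMap_mono M (h t))
    have h2 : star (b + algebraMap ℝ M t) * (b + algebraMap ℝ M t)
        = b * b + (2 * t) • b + algebraMap ℝ M (t ^ 2) := by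
      rw [hsa.star_eq]
      simp only [Algebra.algebraMap_eq_smul_one, add_mul, mul_add, smul_mul_assoc,
        mul_smul_comm, one_mul, mul_one]
      module
    rw [h2, map_add] at h1
    have h3 : b * b + (2 * t) • b ≤ algebraMap ℝ M (r ^ 2) := le_of_add_le_add_right h1
    have h4 : (2 * t) • b ≤ algebraMap ℝ M (r ^ 2) :=
      (le_add_of_nonneg_left hb.mul_self_nonneg).trans h3
    have h5 := smul_le_smul_of_nonneg_left h4 (by norm_num : (0 : ℝ) ≤ 1 / 2)
    convert h5 using 1
    · module
    · simp only [Algebra.algebraMap_eq_smul_one]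
      module
  refine le_antisymm (nonpos_of_forall_smul_le fun t _ => key t) ?_
  rw [← neg_nonpos]
  refine nonpos_of_forall_smul_le (r := r ^ 2 / 2) fun t _ => ?_
  simpa using key (-t)

end CStar

/-! ### Order and weak-⋆ limits -/

namespace PredualLimit

variable {M X : Type*} [CStarAlgebra M] [NormedAddCommGroup X] [NormedSpace ℂ X]
  [PartialOrder M] [StarOrderedRing M]
  {e : StrongDual ℂ X ≃ₗᵢ⋆[ℂ] M} {x y : ℕ → M} {a b : M}

/-- The bounds `‖x + i t‖² ≤ r² + t²` hold for self-adjoint `x` in the `r`-ball and survive the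
limit because balls are weak-⋆ closed. They rule out an imaginary part of `a`. -/
theorem isSelfAdjoint (h : PredualLimit e x a) {r : ℝ} (hr : ∀ᶠ n in atTop, ‖x n‖ ≤ r)
    (hx : ∀ᶠ n in atTop, IsSelfAdjoint (x n)) : IsSelfAdjoint a := by
  suffices hb : (imaginaryPart a : M) = 0 by
    rw [← realPart_add_I_smul_imaginaryPart a, hb]
    simp
  refine eq_zero_of_forall_norm_sq_add_le (imaginaryPart a).2 (r := r) fun t => ?_
  have h1 : ‖a + (t * Complex.I) • (1 : M)‖ ≤ √(r ^ 2 + t ^ 2) :=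
    (h.add (const e ((t * Complex.I) • (1 : M)))).norm_le <| (hr.and hx).mono fun n hn =>
      Real.le_sqrt_of_sq_le (norm_sq_add_I_smul_le hn.2 hn.1 t)
  have h2 : (imaginaryPart (a + (t * Complex.I) • (1 : M)) : M)
      = imaginaryPart a + algebraMap ℝ M t := by
    rw [map_add, mul_comm, mul_smul, imaginaryPart_I_smul]
    simp [Algebra.algebraMap_eq_smul_one]
  rw [← h2]
  calc _ ≤ √(r ^ 2 + t ^ 2) ^ 2 := by
        gcongr
        exact (imaginaryPart.norm_le _).trans h1
    _ = _ := Real.sq_sqrt (by positivity)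

/-- For self-adjoint elements of the `r`-ball, positivity amounts to `‖r - x‖ ≤ r`, again a weak-⋆
closed condition. -/
theorem nonneg (h : PredualLimit e x a) {r : ℝ} (hr : ∀ᶠ n in atTop, ‖x n‖ ≤ r)
    (hx : ∀ᶠ n in atTop, 0 ≤ x n) : 0 ≤ a := by
  have hsa : IsSelfAdjoint a := h.isSelfAdjoint hr (hx.mono fun n hn => .of_nonneg hn)
  have hr0 : 0 ≤ r := by
    obtain ⟨n, hn⟩ := hr.exists
    exact (norm_nonneg _).trans hn
  have h1 : ‖algebraMap ℝ M r - a‖ ≤ r := by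
    refine ((const e (algebraMap ℝ M r)).sub h).norm_le ((hr.and hx).mono fun n hn => ?_)
    have hle : x n ≤ algebraMap ℝ M r := (CStarAlgebra.norm_le_iff_le_algebraMap _ hr0 hn.2).mp hn.1
    rw [CStarAlgebra.norm_le_iff_le_algebraMap _ hr0 (sub_nonneg.mpr hle)]
    exact sub_le_self _ hn.2
  have h2 : algebraMap ℝ M r - a ≤ algebraMap ℝ M r :=
    ((IsSelfAdjoint.algebraMap M (.all r)).sub hsa).le_algebraMap_norm_self.trans
      (algebraMap_mono M h1)
  simpa using h2

theorem le (h : PredualLimit e x a) (h' : PredualLimit e y b) {r s : ℝ} (hr : ∀ n, ‖x n‖ ≤ r)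
    (hs : ∀ n, ‖y n‖ ≤ s) (hxy : ∀ᶠ n in atTop, x n ≤ y n) : a ≤ b :=
  sub_nonneg.mp <| (h'.sub h).nonneg (r := s + r)
    (.of_forall fun n => (norm_sub_le _ _).trans (add_le_add (hs n) (hr n)))
    (hxy.mono fun _ hn => sub_nonneg.mpr hn)

theorem isLUB (h : PredualLimit e x a) {r : ℝ} (hr : ∀ n, ‖x n‖ ≤ r) (hx : Monotone x) :
    IsLUB (Set.range x) a := by
  constructor
  · rintro _ ⟨m, rfl⟩
    exact (const e (x m)).le h (fun _ => le_rfl) hr ((eventually_ge_atTop m).mono fun n hn => hx hn)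
  · intro w hw
    exact h.le (const e w) hr (fun _ => le_rfl) (.of_forall fun n => hw ⟨n, rfl⟩)

/-- Conjugation by a unit is an order automorphism, so it carries the supremum `a` to the supremum
of the conjugates, which is also their limit. -/
theorem conjugate_of_isUnit (h : PredualLimit e x a) {r : ℝ} (hr : ∀ n, ‖x n‖ ≤ r)
    (hx : Monotone x) {u : M} (hu : IsUnit u) :
    PredualLimit e (fun n => star u * x n * u) (star u * a * u) := by
  have hb : ∀ n, ‖star u * x n * u‖ ≤ ‖star u‖ * r * ‖u‖ := fun n => by
    calc _ ≤ ‖star u‖ * ‖x n‖ * ‖u‖ := (norm_mul_le _ _).trans (by gcongr; exact norm_mul_le _ _)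
      _ ≤ _ := by gcongr; exact hr n
  obtain ⟨b, hlim⟩ := exists_of_norm_le e hb
  have hmono : Monotone fun n => star u * x n * u :=
    fun m n hmn => star_left_conjugate_le_conjugate (hx hmn) u
  have hlub := hlim.isLUB hb hmono
  suffices IsLUB (Set.range fun n => star u * x n * u) (star u * a * u) by
    rwa [this.unique hlub]
  have hiff : ∀ p q : M, star u * p * u ≤ star u * q * u ↔ p ≤ q := fun p q => by
    rw [← sub_nonneg, ← mul_sub_right_distrib, ← mul_sub_left_distrib,
      hu.star_left_conjugate_nonneg_iff, sub_nonneg]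
  have hL := h.isLUB hr hx
  refine ⟨?_, fun w hw => ?_⟩
  · rintro _ ⟨n, rfl⟩
    exact (hiff _ _).mpr (hL.1 ⟨n, rfl⟩)
  · obtain ⟨v, rfl⟩ := hu
    have hw' : w = star (v : M) * (star (↑v⁻¹ : M) * w * (↑v⁻¹ : M)) * v := by
      have h1 : star (v : M) * star (↑v⁻¹ : M) = 1 := by rw [← star_mul]; simp
      calc w = (star (v : M) * star (↑v⁻¹ : M)) * w * (↑v⁻¹ * v) := by simp [h1]
        _ = _ := by noncomm_ring
    rw [hw', hiff]
    refine hL.2 ?_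
    rintro _ ⟨n, rfl⟩
    rw [← hiff, ← hw']
    exact hw ⟨n, rfl⟩

/-- Left multiplication commutes with limits of bounded monotone sequences. -/
theorem mul_left (h : PredualLimit e x a) {r : ℝ} (hr : ∀ n, ‖x n‖ ≤ r)
    (hx : Monotone x) (d : M) : PredualLimit e (fun n => d * x n) (d * a) := by
  have hs : 0 < ‖star d‖ + 1 := by positivity
  set s : ℝ := ‖star d‖ + 1 with hsdef
  -- The scaling gives `‖q‖ < 1`, so `1 + ζ q` is a unit for each fourth root of unity `ζ`.
  -- Polarizing `1` against `q` then recovers `q⋆ x = s⁻¹ d x`.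
  set q : M := (s⁻¹ : ℂ) • star d with hq
  have hq1 : ‖q‖ < 1 := by
    rw [hq, norm_smul, norm_inv, Complex.norm_of_nonneg hs.le, inv_mul_lt_iff₀ hs, hsdef]
    simp
  have hc : ∀ ζ : ℂ, ‖ζ‖ = 1 → PredualLimit e
      (fun n => star (1 + ζ • q) * x n * (1 + ζ • q)) (star (1 + ζ • q) * a * (1 + ζ • q)) := by
    refine fun ζ hζ => h.conjugate_of_isUnit hr hx ?_
    have : IsUnit (1 - (-ζ) • q) := isUnit_one_sub_of_norm_lt_one (by simpa [norm_smul, hζ] using hq1)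
    simpa using this
  have hsum := (((hc 1 (by simp)).add ((hc (-1) (by simp)).smul (-1))).add
    ((hc Complex.I (by simp)).smul Complex.I)).add
    ((hc (-Complex.I) (by simp)).smul (-Complex.I))
  simp only [← polarization] at hsum
  have h4 := hsum.smul ((s : ℂ) / 4)
  have hfin : ∀ y : M, ((s : ℂ) / 4) • (4 : ℂ) • (star q * y * 1) = d * y := fun y => by
    have hs' : (s : ℂ) ≠ 0 := by exact_mod_cast hs.ne'
    rw [hq, star_smul, star_star, mul_one, smul_mul_assoc, smul_smul, smul_smul]
    rw [show star ((s : ℂ)⁻¹) = (s : ℂ)⁻¹ by simp]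
    rw [show (s : ℂ) / 4 * 4 * (s : ℂ)⁻¹ = 1 by field_simp, one_smul]
  simpa only [hfin] using h4

end PredualLimit

/-! ### Factorization in a W⋆-algebra -/

section Douglas

variable {M : Type*} [CStarAlgebra M] [PartialOrder M] [StarOrderedRing M]

/-- With `w = v⋆ p⁻¹ v`, conjugating the hypothesis by `p⁻¹ v` gives `w² ≤ k w`. -/
theorem norm_conjugate_inv_le {v : M} {p : Mˣ} (hp : 0 ≤ (p : M)) {k : ℝ} (hk : 0 ≤ k)
    (h : v * star v ≤ k • (p : M)) : ‖star v * ↑p⁻¹ * v‖ ≤ k := by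
  set w := star v * ↑p⁻¹ * v with hw
  have hinv : (0 : M) ≤ ↑p⁻¹ := CFC.inv_nonneg_of_nonneg p hp
  have hw0 : 0 ≤ w := star_left_conjugate_nonneg hinv v
  have hstar : star (↑p⁻¹ * v : M) = star v * ↑p⁻¹ := by rw [star_mul, hinv.star_eq]
  have h1 : star w * w ≤ k • w := by
    have := star_left_conjugate_le_conjugate h (↑p⁻¹ * v)
    rw [hstar] at this
    calc star w * w = star v * ↑p⁻¹ * (v * star v) * (↑p⁻¹ * v) := by
          rw [hw0.star_eq, hw]; noncomm_ring
      _ ≤ _ := this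
      _ = k • (star v * (↑p⁻¹ * p) * (↑p⁻¹ * v)) := by
          simp only [mul_smul_comm, smul_mul_assoc, mul_assoc]
      _ = k • w := by rw [Units.inv_mul, mul_one, hw, mul_assoc]
  have h2 : ‖w‖ * ‖w‖ ≤ k * ‖w‖ := by
    rw [← CStarRing.norm_star_mul_self]
    refine (CStarAlgebra.norm_le_norm_of_nonneg_of_le (star_mul_self_nonneg w) h1).trans ?_
    rw [norm_smul, Real.norm_of_nonneg hk]
  rcases (norm_nonneg w).eq_or_lt with h0 | h0
  · rw [← h0]; exact hk
  · exact le_of_mul_le_mul_right h2 h0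

theorem norm_smul_inv_mul_sq_le {v : M} {p : Mˣ} {ε : ℝ} (hε : 0 ≤ ε)
    (hp : algebraMap ℝ M ε ≤ p) :
    ‖ε • (↑p⁻¹ * v : M)‖ ^ 2 ≤ ε * ‖star v * ↑p⁻¹ * v‖ := by
  have hp0 : (0 : M) ≤ p := (algebraMap_nonneg M hε).trans hp
  have hinv : (0 : M) ≤ ↑p⁻¹ := CFC.inv_nonneg_of_nonneg p hp0
  have hstar : star (↑p⁻¹ * v : M) = star v * ↑p⁻¹ := by rw [star_mul, hinv.star_eq]
  have h1 : ε • (star (↑p⁻¹ * v) * (↑p⁻¹ * v : M)) ≤ star v * ↑p⁻¹ * v := by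
    have := star_left_conjugate_le_conjugate hp (↑p⁻¹ * v)
    calc _ = _ := by
          rw [Algebra.algebraMap_eq_smul_one, mul_smul_comm, mul_one, smul_mul_assoc]
      _ ≤ _ := this
      _ = star v * (↑p⁻¹ * p) * (↑p⁻¹ * v) := by rw [hstar]; simp only [mul_assoc]
      _ = _ := by rw [Units.inv_mul, mul_one, mul_assoc]
  have h2 := CStarAlgebra.norm_le_norm_of_nonneg_of_le
    (smul_nonneg hε (star_mul_self_nonneg _)) h1
  rw [norm_smul, CStarRing.norm_star_mul_self, Real.norm_of_nonneg hε] at h2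
  rw [norm_smul, Real.norm_of_nonneg hε]
  calc _ = ε * (ε * (‖(↑p⁻¹ * v : M)‖ * ‖(↑p⁻¹ * v : M)‖)) := by ring
    _ ≤ _ := by gcongr

/-- Parallelogram identity with the nonnegative term for `p - ζ q` dropped. -/
theorem add_smul_mul_star_le (p q : M) {ζ : ℂ} (hζ : ‖ζ‖ = 1) :
    (p + ζ • q) * star (p + ζ • q) ≤ (2 : ℝ) • (p * star p) + (2 : ℝ) • (q * star q) := by
  have h : 0 ≤ (p - ζ • q) * star (p - ζ • q) := mul_star_self_nonneg _
  have hz : ζ * star ζ = 1 := by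
    rw [RCLike.star_def, Complex.mul_conj, Complex.normSq_eq_norm_sq, hζ]; simp
  have hsum : (p + ζ • q) * star (p + ζ • q) + (p - ζ • q) * star (p - ζ • q)
      = (2 : ℝ) • (p * star p) + (2 : ℝ) • (q * star q) := by
    have hqq : (ζ • q) * star (ζ • q) = q * star q := by
      rw [star_smul, smul_mul_smul_comm, hz, one_smul]
    rw [← hqq, two_smul, two_smul, star_add, star_sub]
    noncomm_ring
  rw [← hsum]
  exact le_add_of_nonneg_right h

/-- The factorization lemma of Douglas in a W⋆-algebra. -/
theorem exists_mul_eq_of_mul_star_le [WStarAlgebra M] {a b : M} {k : ℝ} (hk : 0 ≤ k)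
    (h : b * star b ≤ k • (a * star a)) : ∃ d, a * d = b := by
  obtain ⟨X, _, _, _, ⟨e⟩⟩ := WStarAlgebra.exists_predual (M := M)
  have haa : 0 ≤ a * star a := mul_star_self_nonneg a
  let ε : ℕ → ℝ := fun n => 1 / ((n : ℝ) + 1)
  have hε : ∀ n, 0 < ε n := fun n => Nat.one_div_pos_of_nat
  have hunit : ∀ n, IsUnit (a * star a + algebraMap ℝ M (ε n)) := fun n =>
    CStarAlgebra.isUnit_of_le (algebraMap ℝ M (ε n)) (le_add_of_nonneg_left haa)
      (isStrictlyPositive_algebraMap (hε n))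
  choose p hp using hunit
  have hεp : ∀ n, algebraMap ℝ M (ε n) ≤ p n := fun n => by
    rw [hp]; exact le_add_of_nonneg_left haa
  have hap : ∀ n, a * star a ≤ p n := fun n => by
    rw [hp]; exact le_add_of_nonneg_right (algebraMap_nonneg M (hε n).le)
  have hp0 : ∀ n, 0 ≤ (p n : M) := fun n => haa.trans (hap n)
  have hmono : ∀ v : M, Monotone fun n => star v * ↑(p n)⁻¹ * v := fun v m n hmn => by
    refine star_left_conjugate_le_conjugate (CStarAlgebra.inv_le_inv (hp0 n) ?_) v
    rw [hp, hp]
    gcongr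
    exact Nat.one_div_le_one_div hmn
  have hbdd : ∀ ζ : ℂ, ‖ζ‖ = 1 → ∀ n,
      ‖star (b + ζ • a) * ↑(p n)⁻¹ * (b + ζ • a)‖ ≤ 2 * k + 2 := fun ζ hζ n => by
    refine norm_conjugate_inv_le (hp0 n) (by positivity) ?_
    calc _ ≤ _ := add_smul_mul_star_le b a hζ
      _ ≤ (2 : ℝ) • (k • (a * star a)) + (2 : ℝ) • (a * star a) := by gcongr
      _ = (2 * k + 2) • (a * star a) := by module
      _ ≤ _ := by
        gcongr
        exact hap n
  have hlim : ∀ ζ : ℂ, ‖ζ‖ = 1 → ∃ s, PredualLimit e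
      (fun n => a * (star (b + ζ • a) * ↑(p n)⁻¹ * (b + ζ • a))) (a * s) := fun ζ hζ => by
    obtain ⟨s, hs⟩ := PredualLimit.exists_of_norm_le e (hbdd ζ hζ)
    exact ⟨s, hs.mul_left (hbdd ζ hζ) (hmono _) a⟩
  obtain ⟨s₁, h₁⟩ := hlim 1 (by simp)
  obtain ⟨s₂, h₂⟩ := hlim (-1) (by simp)
  obtain ⟨s₃, h₃⟩ := hlim Complex.I (by simp)
  obtain ⟨s₄, h₄⟩ := hlim (-Complex.I) (by simp)
  have hsum := (((h₁.add (h₂.smul (-1))).add (h₃.smul Complex.I)).add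
    (h₄.smul (-Complex.I))).smul (4 : ℂ)⁻¹
  have hcomm : ∀ (c : ℂ) (y : M), c • (a * y) = a * (c • y) := fun c y => (mul_smul_comm c a y).symm
  simp only [hcomm, ← mul_add, ← polarization] at hsum
  -- Since `a a⋆ = pₙ - εₙ`, the error is `-εₙ pₙ⁻¹ b`, of norm at most `√(εₙ k)`.
  have hnorm : PredualLimit e (fun n => a * ((4 : ℂ)⁻¹ • (4 : ℂ) • (star a * ↑(p n)⁻¹ * b))) b := by
    refine PredualLimit.of_tendsto (tendsto_iff_norm_sub_tendsto_zero.mpr ?_)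
    have hdiff : ∀ n, a * ((4 : ℂ)⁻¹ • (4 : ℂ) • (star a * ↑(p n)⁻¹ * b)) - b
        = -(ε n • (↑(p n)⁻¹ * b : M)) := fun n => by
      rw [smul_smul, inv_mul_cancel₀ (by norm_num), one_smul]
      have hpn : a * star a = p n - algebraMap ℝ M (ε n) := by rw [hp]; abel
      calc _ = (a * star a) * (↑(p n)⁻¹ * b) - b := by simp only [mul_assoc]
        _ = _ := by
          rw [hpn, sub_mul, Units.mul_inv_cancel_left, ← Algebra.smul_def]; abel
    have hle : ∀ n, ‖a * ((4 : ℂ)⁻¹ • (4 : ℂ) • (star a * ↑(p n)⁻¹ * b)) - b‖ ≤ √(ε n * k) := by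
      refine fun n => Real.le_sqrt_of_sq_le ?_
      rw [hdiff, norm_neg]
      refine (norm_smul_inv_mul_sq_le (hε n).le (hεp n)).trans ?_
      refine mul_le_mul_of_nonneg_left (norm_conjugate_inv_le (hp0 n) hk (h.trans ?_)) (hε n).le
      gcongr
      exact hap n
    have hz : Tendsto (fun n => √(ε n * k)) atTop (𝓝 0) := by
      have := (tendsto_one_div_add_atTop_nhds_zero_nat (𝕜 := ℝ)).mul_const k
      simpa [ε] using this.sqrt
    exact squeeze_zero (fun _ => norm_nonneg _) hle hz
  exact ⟨_, hsum.unique hnorm⟩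

end Douglas

/-! ### The form order on `𝓛(E)` is the C⋆-order -/

section Order

variable {𝒜 E : Type*} [NonUnitalCStarAlgebra 𝒜] [PartialOrder 𝒜] [StarOrderedRing 𝒜]
  [SMul 𝒜 E] [NormedAddCommGroup E] [NormedSpace ℂ E] [CStarModule 𝒜 E]

namespace Adjointable

theorem le_def {T S : Adjointable 𝒜 E} : T ≤ S ↔ ∀ x : E, ⟪x, T x⟫_𝒜 ≤ ⟪x, S x⟫_𝒜 := Iff.rfl

theorem zero_apply (x : E) : (0 : Adjointable 𝒜 E) x = 0 := rfl

theorem neg_apply (T : Adjointable 𝒜 E) (x : E) : (-T) x = -T x := rfl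

theorem nonneg_def {T : Adjointable 𝒜 E} : 0 ≤ T ↔ ∀ x : E, 0 ≤ ⟪x, T x⟫_𝒜 := by
  simp [le_def, zero_apply]

theorem star_mul_self_nonneg (T : Adjointable 𝒜 E) : 0 ≤ star T * T :=
  nonneg_def.mpr fun x => by
    rw [mul_apply, ← inner_left]
    exact CStarModule.inner_self_nonneg

theorem isSelfAdjoint_of_nonneg {T : Adjointable 𝒜 E} (hT : 0 ≤ T) : IsSelfAdjoint T := by
  have h : ∀ x : E, ⟪x, (star T) x⟫_𝒜 = ⟪x, T x⟫_𝒜 := fun x => by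
    rw [← inner_left, ← CStarModule.star_inner x (T x),
      (IsSelfAdjoint.of_nonneg (nonneg_def.mp hT x)).star_eq]
  exact le_antisymm (fun x => (h x).le) (fun x => (h x).ge)

/-- Write `T = p² - n²` with `p n = 0` by functional calculus. Then `n T n = -n⁴`, while form
positivity of `T` passes to `n T n`; hence `n = 0` in effect and `T = p²`. -/
instance [CompleteSpace E] : StarOrderedRing (Adjointable 𝒜 E) := by
  refine .of_nonneg_iff' (fun {S T} h R x => ?_) fun T => ⟨fun hT => ?_, ?_⟩
  · simpa using h x
  · have hsa := isSelfAdjoint_of_nonneg hT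
    set n : Adjointable 𝒜 E := cfc (fun t : ℝ => √(-t)) T with hn
    set p : Adjointable 𝒜 E := cfc (fun t : ℝ => √t) T with hp
    have hnsa : IsSelfAdjoint n := cfc_predicate _ _
    have hpsa : IsSelfAdjoint p := cfc_predicate _ _
    have hsum : T + n * n = p * p := by
      conv_lhs => rw [← cfc_id' ℝ T]
      rw [hn, hp, ← cfc_mul .., ← cfc_add .., ← cfc_mul ..]
      refine cfc_congr fun t _ => ?_
      rcases le_total 0 t with ht | ht
      · simp [Real.sqrt_eq_zero_of_nonpos (neg_nonpos.mpr ht), Real.mul_self_sqrt ht]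
      · simp [Real.sqrt_eq_zero_of_nonpos ht, Real.mul_self_sqrt (neg_nonneg.mpr ht)]
    have hpn : p * n = 0 := by
      rw [hn, hp, ← cfc_mul .., ← cfc_zero ℝ T]
      refine cfc_congr fun t _ => ?_
      rcases le_total 0 t with ht | ht
      · simp [Real.sqrt_eq_zero_of_nonpos (neg_nonpos.mpr ht)]
      · simp [Real.sqrt_eq_zero_of_nonpos ht]
    have hconj : n * T * n = -(star (n * n) * (n * n)) := by
      rw [eq_sub_of_add_eq hsum, star_mul, hnsa.star_eq]
      calc _ = n * p * (p * n) - n * n * (n * n) := by noncomm_ring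
        _ = _ := by rw [hpn, mul_zero, zero_sub]
    have hnn : star (n * n) * (n * n) = 0 := by
      refine le_antisymm (fun x => ?_) (star_mul_self_nonneg _)
      have h1 : 0 ≤ ⟪x, (n * T * n) x⟫_𝒜 := by
        have := nonneg_def.mp hT (n x)
        rwa [inner_left, hnsa.star_eq] at this
      rw [hconj, neg_apply, CStarModule.inner_neg_right, neg_nonneg] at h1
      simpa [zero_apply] using h1
    have hn0 : n * n = 0 := CStarRing.star_mul_self_eq_zero_iff _ |>.mp hnn
    exact ⟨p, by rw [hpsa.star_eq, ← hsum, hn0, add_zero]⟩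
  · rintro ⟨S, rfl⟩
    exact star_mul_self_nonneg S

end Adjointable

end Order

/-! ### Factorization from range inclusion -/

namespace Adjointable

variable {𝒜 E : Type*} [NonUnitalCStarAlgebra 𝒜] [PartialOrder 𝒜] [StarOrderedRing 𝒜]
  [SMul 𝒜 E] [NormedAddCommGroup E] [NormedSpace ℂ E] [CStarModule 𝒜 E]

/-- A vector killed by `A` is orthogonal to the dense range of `A⋆`. -/
theorem injective_of_denseRange_star {A : Adjointable 𝒜 E}
    (hA : DenseRange (star A).toCLM) : Function.Injective A.toCLM := by
  rw [injective_iff_map_eq_zero]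
  intro x hx
  refine ext_inner 𝒜 fun z => ?_
  rw [CStarModule.inner_zero_right, ← CStarModule.star_inner, star_eq_zero]
  refine congrFun (hA.equalizer (CStarModule.innerSL (A := 𝒜) x).continuous continuous_const ?_) z
  funext y
  change ⟪x, (star A) y⟫_𝒜 = 0
  rw [← inner_left, hx, CStarModule.inner_zero_left]

/-- If `A⋆` has dense range and the range of `B` lies in that of `A`, then the solution `C` of
`A C = B` is adjointable. -/
theorem exists_mul_eq_of_range_subset [CompleteSpace E] {A B : Adjointable 𝒜 E}
    (hA : DenseRange (star A).toCLM) (h : Set.range B.toCLM ⊆ Set.range A.toCLM) :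
    ∃ C : Adjointable 𝒜 E, A * C = B := by
  have hinj := injective_of_denseRange_star hA
  choose c hc using fun x => h ⟨x, rfl⟩
  let L : E →ₗ[ℂ] E :=
    { toFun := c
      map_add' := fun x y => hinj (by simp [hc])
      map_smul' := fun t x => hinj (by simp [hc]) }
  have hL : Continuous L := L.continuous_of_seq_closed_graph fun u x y hu hy => hinj <| by
    have h1 := (A.toCLM.continuous.tendsto y).comp hy
    have h2 := (B.toCLM.continuous.tendsto x).comp hu
    have h3 : (A.toCLM ∘ L ∘ u) = B.toCLM ∘ u := funext fun n => hc (u n)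
    rw [h3] at h1
    exact (tendsto_nhds_unique h1 h2).trans (hc x).symm
  let C : E →L[ℂ] E := ⟨L, hL⟩
  have hC : ∀ x, A (C x) = B x := hc
  have hCA : ∀ x y, ⟪C x, (star A) y⟫_𝒜 = ⟪x, (star B) y⟫_𝒜 := fun x y => by
    rw [← inner_left, ← inner_left, hC]
  -- This makes `A⋆ y ↦ B⋆ y` well defined and bounded on a dense subspace; its extension `D` is the
  -- adjoint of `C`.
  have hnorm : ∀ y, ‖(star B) y‖ ≤ ‖C‖ * ‖(star A) y‖ := fun y => by
    have h1 : ‖(star B) y‖ ^ 2 ≤ ‖C‖ * ‖(star B) y‖ * ‖(star A) y‖ := by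
      rw [CStarModule.norm_sq_eq 𝒜, ← hCA]
      refine (CStarModule.norm_inner_le E).trans ?_
      gcongr
      exact C.le_opNorm _
    rcases (norm_nonneg ((star B) y)).eq_or_lt with h0 | h0
    · rw [← h0]; positivity
    · refine le_of_mul_le_mul_right ?_ h0
      linarith
  let D : E →L[ℂ] E := (star B).toCLM.toLinearMap.extendOfNorm (star A).toCLM.toLinearMap
  have hD : ∀ y, D ((star A) y) = (star B) y :=
    LinearMap.extendOfNorm_eq (e := (star A).toCLM.toLinearMap) hA ⟨_, hnorm⟩
  refine ⟨⟨C, D, fun x z => ?_⟩, ext hC⟩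
  refine congrFun (hA.equalizer (CStarModule.innerSL (A := 𝒜) (C x)).continuous
    ((CStarModule.innerSL (A := 𝒜) x).continuous.comp D.continuous) (funext fun y => ?_)) z
  change ⟪C x, (star A) y⟫_𝒜 = ⟪x, D ((star A) y)⟫_𝒜
  rw [hCA, hD]

theorem range_mul_subset (A C : Adjointable 𝒜 E) :
    Set.range (A * C).toCLM ⊆ Set.range A.toCLM := by
  rintro _ ⟨x, rfl⟩
  exact ⟨C x, rfl⟩

end Adjointable

end HilbertModule

theorem theorem2 {𝒜 E : Type*} [NonUnitalCStarAlgebra 𝒜] [PartialOrder 𝒜] [StarOrderedRing 𝒜]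
    [NormedAddCommGroup E] [NormedSpace ℂ E] [CompleteSpace E] [SMul 𝒜 E] [CStarModule 𝒜 E]
    [WStarAlgebra (HilbertModule.Adjointable 𝒜 E)]
    (A B : HilbertModule.Adjointable 𝒜 E)
    (hA : closure (Set.range (star A).toCLM) = Set.univ) :
    (∃ c : ℝ, 0 < c ∧ B * star B ≤ c • (A * star A)) ↔ Set.range B.toCLM ⊆ Set.range A.toCLM := by
  constructor
  · rintro ⟨c, hc, h⟩
    obtain ⟨C, rfl⟩ := HilbertModule.exists_mul_eq_of_mul_star_le hc.le h
    exact HilbertModule.Adjointable.range_mul_subset A C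
  · intro h
    obtain ⟨C, rfl⟩ := HilbertModule.Adjointable.exists_mul_eq_of_range_subset
      (dense_iff_closure_eq.mpr hA) h
    -- The `+ 1` keeps the constant strictly positive when `C = 0`.
    refine ⟨‖C * star C‖ + 1, by positivity, ?_⟩
    calc A * C * star (A * C) = A * (C * star C) * star A := by
          rw [star_mul]; noncomm_ring
      _ ≤ ‖C * star C‖ • (A * star A) :=
          CStarAlgebra.star_right_conjugate_le_norm_smul (.mul_star_self C)
      _ ≤ (‖C * star C‖ + 1) • (A * star A) :=
          smul_le_smul_of_nonneg_right (by linarith) (mul_star_self_nonneg A)
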